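/- **Conventions.** A directed graph $E=(E^0,E^1,r,s)$ has countable sets $E^0$ of vertices and $E^1$ of edges and maps $r,s:E^1\to E^0$ (range and source); a path is a finite sequence $e_1\cdots e_n$ of edges, $n\ge 1$, with $r(e_i)=s(e_{i+1})$. It is *row-finite* if $s^{-1}(v)$ is finite for every $v\in E^0$. A vertex is a *sink* if $s^{-1}(v)=\emptyset$ and a *source* if $r^{-1}(v)=\emptyset$. A labelled graph $(E,\pi)$ is a directed graph with a map $\pi:E^1\to\mathcal A$ into a set (alphabet). It is *left-resolving* if $\pi$ is injective on $r^{-1}(v)$ for every $v$, and *label-finite* if $\pi^{-1}(a)$ is finite for every $a\in\pi(E^1)$. Let $\mathcal L(E,\pi)$ be the set of words $\pi(e_1)\cdots\pi(e_n)$, where $e_1\cdots e_n$ is a path of length $n\ge1$. For $\alpha\in\mathcal L(E,\pi)$ let $s(\alpha)$ and $r(\alpha)$ be the sets of sources and of ranges of the paths $\lambda$ with $\pi(\lambda)=\alpha$, and for $A\subseteq E^0$ let $r(A,\alpha)$ be the set of ranges of those paths $\lambda$ with $\pi(\lambda)=\alpha$ and $s(\lambda)\in A$. A collection $\mathcal C\subseteq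 2^{E^0}$ is *accommodating* if it contains $r(\alpha)$ for all $\alpha\in\mathcal L(E,\pi)$, is closed under $A\mapsto r(A,\alpha)$ for all $\alpha\in\mathcal L(E,\pi)$, and is closed under intersections and unions of two sets. Let $\mathcal E^0$ be the smallest accommodating collection containing $\{v\}$ for every source or sink $v$ and all $r(\alpha)$ and $s(\alpha)$, and let $\mathcal E^0_-$ be the smallest accommodating collection containing $\{v\}$ for every sink $v$ and all $r(\alpha)$, where $\alpha\in\mathcal L(E,\pi)$. For $\mathcal C=\mathcal E^0$ or $\mathcal E^0_-$, the $C^*$-algebra $C^*(E,\pi,\mathcal C)$ is the universal $C^*$-algebra generated by projections $p_A$ ($A\in\mathcal C$) and partial isometries $s_a$ ($a\in\pi(E^1)$) such that, for all $A,B\in\mathcal C$ and $a,b\in\pi(E^1)$: 1. $p_Ap_B=p_{A\cap B}$ and $p_{A\cup B}=p_A+p_B-p_{A\cap B}$, where $p_\emptyset=0$; 2. $p_As_a=s_ap_{r(A,a)}$; 3. $s_a^*s_a=p_{r(a)}$, and $s_a^*s_b=0$ unless $a=b$; 4. if $A$ contains no sink and $L^1_A=\{a\in\pi(E^1): A\cap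 s(a)\ne\emptyset\}$ is finite and non-empty, then $p_A=\sum_{a\in L^1_A}s_ap_{r(A,a)}s_a^*$. The graph algebra $C^*(E)$ is the universal $C^*$-algebra generated by mutually orthogonal projections $p_v$ ($v\in E^0$) and partial isometries $s_e$ ($e\in E^1$) with mutually orthogonal ranges such that $s_e^*s_e=p_{r(e)}$, $s_es_e^*\le p_{s(e)}$, and $p_v=\sum_{s(e)=v}s_es_e^*$ whenever $0<|s^{-1}(v)|<\infty$. **Theorem.** Let $(E,\pi)$ be a row-finite, left-resolving, label-finite labelled graph. If $\{v\}\in\mathcal E^0$ for all $v\in E^0$, then $C^*(E,\pi,\mathcal E^0)\cong C^*(E)$ as $C^*$-algebras. If $\{v\}\in\mathcal E^0_-$ for all $v\in E^0$, then $C^*(E,\pi,\mathcal E^0_-)\cong C^*(E)$ as $C^*$-algebras. -/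

import Mathlib

open scoped ENNReal

universe w u v x

noncomputable section

/-! ### Directed graphs and labelled graphs -/

/-- A directed graph with vertex set `V` and edge set `E`; `s e` and `r e` are the source and the
range of the edge `e`. (Countability of `V` and `E` is assumed separately.) -/
structure DirGraph (V : Type u) (E : Type v) where
  s : E → V
  r : E → V

namespace DirGraph

variable {V : Type u} {E : Type v} (Γ : DirGraph V E)

/-- `v` is a sink if it emits no edge. -/
def IsSink (v : V) : Prop := ∀ e, Γ.s e ≠ v

/-- `v` is a source if it receives no edge. -/
def IsSource (v : V) : Prop := ∀ e, Γ.r e ≠ v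

/-- Every vertex emits only finitely many edges. -/
def IsRowFinite : Prop := ∀ v, {e | Γ.s e = v}.Finite

/-- `e₁ … eₙ` is a path if `r eᵢ = s eᵢ₊₁` for all `i`. -/
def IsPath (l : List E) : Prop := l.IsChain fun e f => Γ.r e = Γ.s f

/-- Cuntz-Krieger `Γ`-families in a C⋆-algebra `D`: mutually orthogonal projections `p v` and
partial isometries `t e` with mutually orthogonal ranges satisfying the graph relations. -/
structure IsCKFamily {D : Type w} [NonUnitalCStarAlgebra D] (p : V → D) (t : E → D) : Prop where
  proj : ∀ v, IsStarProjection (p v)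
  orth : ∀ v v', v ≠ v' → p v * p v' = 0
  partialIsometry : ∀ e, t e * star (t e) * t e = t e
  range_orth : ∀ e f, e ≠ f → star (t e) * t f = 0
  star_mul_self : ∀ e, star (t e) * t e = p (Γ.r e)
  /-- `t e * star (t e) ≤ p (s e)`, an inequality of projections -/
  range_le : ∀ e, p (Γ.s e) * (t e * star (t e)) = t e * star (t e)
  sum_eq : ∀ v (hv : {e | Γ.s e = v}.Finite), {e | Γ.s e = v}.Nonempty →
    p v = ∑ e ∈ hv.toFinset, t e * star (t e)

end DirGraph

/-- A labelled graph `(E, π)` over the alphabet `A`; `lab` is the labelling map `π`, which is not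
required to be onto. -/
structure LabGraph (V : Type u) (E : Type v) (A : Type x) extends DirGraph V E where
  lab : E → A

namespace LabGraph

variable {V : Type u} {E : Type v} {A : Type x} (Γ : LabGraph V E A)

/-- Distinct edges with the same range carry distinct labels. -/
def IsLeftResolving : Prop := ∀ v, Set.InjOn Γ.lab {e | Γ.r e = v}

/-- The set of labels that occur, i.e. the labelled paths of length one. -/
def labels : Set A := Set.range Γ.lab

/-- Every label that occurs is carried by only finitely many edges. -/
def IsLabelFinite : Prop := ∀ a ∈ Γ.labels, {e | Γ.lab e = a}.Finite

/-- The labelled paths: words represented by some path of length at least one. -/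
def language : Set (List A) := {α | ∃ l : List E, l ≠ [] ∧ Γ.IsPath l ∧ l.map Γ.lab = α}

/-- `s(α)`: the sources of the paths representing `α`. -/
def wordSource (α : List A) : Set V :=
  {v | ∃ (l : List E) (h : l ≠ []), Γ.IsPath l ∧ l.map Γ.lab = α ∧ Γ.s (l.head h) = v}

/-- `r(α)`: the ranges of the paths representing `α`. -/
def wordRange (α : List A) : Set V :=
  {v | ∃ (l : List E) (h : l ≠ []), Γ.IsPath l ∧ l.map Γ.lab = α ∧ Γ.r (l.getLast h) = v}

/-- The relative range `r(B, α)`: the ranges of the paths representing `α` that start in `B`. -/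
def relRange (B : Set V) (α : List A) : Set V :=
  {v | ∃ (l : List E) (h : l ≠ []), Γ.IsPath l ∧ l.map Γ.lab = α ∧ Γ.s (l.head h) ∈ B ∧
    Γ.r (l.getLast h) = v}

theorem singleton_mem_language (a : Γ.labels) : [a.1] ∈ Γ.language := by
  obtain ⟨_, e, rfl⟩ := a
  exact ⟨[e], by simp, by simp [DirGraph.IsPath], by simp⟩

/-- A collection of vertex sets is accommodating if it contains all `r(α)` and is closed under
relative ranges, finite intersections and finite unions. -/
structure IsAccommodating (C : Set (Set V)) : Prop where
  wordRange_mem : ∀ α ∈ Γ.language, Γ.wordRange α ∈ C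
  relRange_mem : ∀ B ∈ C, ∀ α ∈ Γ.language, Γ.relRange B α ∈ C
  inter_mem : ∀ B ∈ C, ∀ B' ∈ C, B ∩ B' ∈ C
  union_mem : ∀ B ∈ C, ∀ B' ∈ C, B ∪ B' ∈ C

/-- A labelled space over `Γ`: an accommodating collection of vertex sets. -/
structure LabSpace where
  sets : Set (Set V)
  acc : Γ.IsAccommodating sets

/-- The smallest accommodating collection containing `S`. -/
def generatedSpace (S : Set (Set V)) : Γ.LabSpace where
  sets := {B | ∀ C, Γ.IsAccommodating C → S ⊆ C → B ∈ C}
  acc :=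
    { wordRange_mem := fun α hα _ hC _ => hC.wordRange_mem α hα
      relRange_mem := fun B hB α hα C hC hS => hC.relRange_mem B (hB C hC hS) α hα
      inter_mem := fun B hB B' hB' C hC hS => hC.inter_mem B (hB C hC hS) B' (hB' C hC hS)
      union_mem := fun B hB B' hB' C hC hS => hC.union_mem B (hB C hC hS) B' (hB' C hC hS) }

/-- The labelled space `𝓔⁰`, generated by the singletons of sources and sinks and by all
`r(α)` and `s(α)`. -/
def E0 : Γ.LabSpace :=
  Γ.generatedSpace ({B | ∃ v, (Γ.IsSource v ∨ Γ.IsSink v) ∧ B = {v}} ∪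
    {B | ∃ α ∈ Γ.language, B = Γ.wordRange α} ∪ {B | ∃ α ∈ Γ.language, B = Γ.wordSource α})

/-- The labelled space `𝓔⁰₋`, generated by the singletons of sinks and by all `r(α)`. -/
def E0minus : Γ.LabSpace :=
  Γ.generatedSpace ({B | ∃ v, Γ.IsSink v ∧ B = {v}} ∪
    {B | ∃ α ∈ Γ.language, B = Γ.wordRange α})

/-- `L¹_B`: the labels of the edges emitted by the set `B`. -/
def emittedLabels (B : Set V) : Set Γ.labels := {a | (B ∩ Γ.wordSource [a.1]).Nonempty}

namespace LabSpace

variable {Γ} (C : Γ.LabSpace)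

/-- `r(a)` as a member of the labelled space. -/
def rangeSet (a : Γ.labels) : C.sets :=
  ⟨Γ.wordRange [a.1], C.acc.wordRange_mem _ (Γ.singleton_mem_language a)⟩

/-- `r(B, a)` as a member of the labelled space. -/
def relRangeSet (B : C.sets) (a : Γ.labels) : C.sets :=
  ⟨Γ.relRange B.1 [a.1], C.acc.relRange_mem _ B.2 _ (Γ.singleton_mem_language a)⟩

/-- The intersection of two members of the labelled space. -/
def interSet (B B' : C.sets) : C.sets := ⟨B.1 ∩ B'.1, C.acc.inter_mem _ B.2 _ B'.2⟩

/-- The union of two members of the labelled space. -/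
def unionSet (B B' : C.sets) : C.sets := ⟨B.1 ∪ B'.1, C.acc.union_mem _ B.2 _ B'.2⟩

/-- Representations of a labelled space in a C⋆-algebra `D`: projections `p B` (`B ∈ C`) and
partial isometries `t a` (`a` a label that occurs). The summation relation is imposed on the sets
`B` that contain no sink; on a graph without sinks this is no restriction. The definition is meant
for weakly left-resolving spaces; every labelled space over a left-resolving graph is one. -/
structure IsRepresentation {D : Type w} [NonUnitalCStarAlgebra D]
    (p : C.sets → D) (t : Γ.labels → D) : Prop where
  proj : ∀ B, IsStarProjection (p B)
  partialIsometry : ∀ a, t a * star (t a) * t a = t a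
  mul_eq : ∀ B B', p B * p B' = p (C.interSet B B')
  union_eq : ∀ B B', p (C.unionSet B B') = p B + p B' - p (C.interSet B B')
  empty_eq : ∀ B : C.sets, B.1 = ∅ → p B = 0
  intertwine : ∀ B a, p B * t a = t a * p (C.relRangeSet B a)
  star_mul_self : ∀ a, star (t a) * t a = p (C.rangeSet a)
  range_orth : ∀ a b, a ≠ b → star (t a) * t b = 0
  sum_eq : ∀ (B : C.sets) (hB : (Γ.emittedLabels B.1).Finite),
    (Γ.emittedLabels B.1).Nonempty → (∀ v ∈ B.1, ¬ Γ.IsSink v) →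
    p B = ∑ a ∈ hB.toFinset, t a * p (C.relRangeSet B a) * star (t a)

end LabSpace

end LabGraph

/-! ### Universal C⋆-algebras

Given a collection of families `f i : G → D i` of contractions in C⋆-algebras `D i`, form the
closed ⋆-subalgebra of the `ℓ^∞`-product of the `D i` generated by the tuples `(f i g)ᵢ`. Applied
to the collection of *all* families satisfying given relations, this is the universal C⋆-algebra
for these relations. -/

section Universal

variable {G : Type u} {ι : Type v} {D : ι → Type w} [∀ i, NonUnitalCStarAlgebra (D i)]
  (f : ∀ i, G → D i) (hf : ∀ i g, ‖f i g‖ ≤ 1)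

/-- The tuple `(f i g)ᵢ` as an element of the `ℓ^∞`-product. -/
def tupleGen (g : G) : lp D ∞ :=
  ⟨fun i => f i g, memℓp_infty ⟨1, by rintro _ ⟨i, rfl⟩; exact hf i g⟩⟩

/-- The C⋆-algebra generated by the tuples `(f i g)ᵢ`. -/
def UnivCStar : Type (max v w) :=
  ((NonUnitalStarAlgebra.adjoin ℂ (Set.range (tupleGen f hf))).topologicalClosure :
    NonUnitalStarSubalgebra ℂ (lp D ∞))

instance : NonUnitalCStarAlgebra (UnivCStar f hf) :=
  NonUnitalStarSubalgebra.nonUnitalCStarAlgebra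
    (h_closed := NonUnitalStarSubalgebra.isClosed_topologicalClosure _)
    (NonUnitalStarAlgebra.adjoin ℂ (Set.range (tupleGen f hf))).topologicalClosure

namespace UnivCStar

/-- The canonical generators. -/
def gen (g : G) : UnivCStar f hf :=
  ⟨tupleGen f hf g, NonUnitalStarSubalgebra.le_topologicalClosure _
    (NonUnitalStarAlgebra.subset_adjoin ℂ _ ⟨g, rfl⟩)⟩

/-- The `i`-th coordinate projection. -/
def eval (i : ι) : UnivCStar f hf →⋆ₙₐ[ℂ] D i where
  toFun y := (y.1 : ∀ i, D i) i
  map_smul' _ _ := rfl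
  map_zero' := rfl
  map_add' _ _ := rfl
  map_mul' _ _ := rfl
  map_star' _ := rfl

theorem eval_gen (i : ι) (g : G) : eval f hf i (gen f hf g) = f i g := rfl

theorem eval_ext {y z : UnivCStar f hf} (h : ∀ i, eval f hf i y = eval f hf i z) : y = z :=
  Subtype.ext (lp.ext (funext h))

/-- A ⋆-homomorphism is determined by its values on the canonical generators. -/
theorem hom_ext {B : Type x} [NonUnitalCStarAlgebra B] {φ ψ : UnivCStar f hf →⋆ₙₐ[ℂ] B}
    (h : ∀ g, φ (gen f hf g) = ψ (gen f hf g)) : φ = ψ := by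
  let K : NonUnitalStarSubalgebra ℂ (UnivCStar f hf) := NonUnitalStarAlgHom.equalizer φ ψ
  let j : UnivCStar f hf →⋆ₙₐ[ℂ] lp D ∞ := NonUnitalStarSubalgebraClass.subtype
    (NonUnitalStarAlgebra.adjoin ℂ (Set.range (tupleGen f hf))).topologicalClosure
  have hK : IsClosed (K : Set (UnivCStar f hf)) :=
    isClosed_eq
      (AddMonoidHomClass.continuous_of_bound φ 1 fun y => by
        simpa using NonUnitalStarAlgHom.norm_apply_le φ y)
      (AddMonoidHomClass.continuous_of_bound ψ 1 fun y => by
        simpa using NonUnitalStarAlgHom.norm_apply_le ψ y)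
  have hj : IsClosed ((K.map j : NonUnitalStarSubalgebra ℂ (lp D ∞)) : Set (lp D ∞)) :=
    ((NonUnitalStarSubalgebra.isClosed_topologicalClosure
      (NonUnitalStarAlgebra.adjoin ℂ
        (Set.range (tupleGen f hf)))).isClosedEmbedding_subtypeVal.isClosedMap) _ hK
  have hle : (NonUnitalStarAlgebra.adjoin ℂ (Set.range (tupleGen f hf))).topologicalClosure ≤
      K.map j := by
    refine NonUnitalStarSubalgebra.topologicalClosure_minimal _
      (NonUnitalStarAlgebra.adjoin_le ?_) hj
    rintro _ ⟨g, rfl⟩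
    exact ⟨gen f hf g, h g, rfl⟩
  ext y
  obtain ⟨z, hz, hzy⟩ := hle y.2
  have hzy' : z = y := Subtype.ext hzy
  exact hzy' ▸ hz

end UnivCStar

end Universal

theorem norm_le_one_of_partialIsometry {D : Type w} [NonUnitalCStarAlgebra D] {t q : D}
    (hq : IsStarProjection q) (h : star t * t = q) : ‖t‖ ≤ 1 := by
  have h1 := CStarRing.norm_star_mul_self (x := t)
  have h2 := hq.norm_le
  rw [h] at h1
  nlinarith [norm_nonneg t]

/-! ### The C⋆-algebra of a directed graph -/

namespace DirGraph

variable {V : Type u} {E : Type v} (Γ : DirGraph V E)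

/-- A Cuntz-Krieger family together with the C⋆-algebra in which it lives. (For a countable graph
such a family generates a separable C⋆-algebra, which has a copy in every universe.) -/
structure CKFamily where
  D : Type w
  [cstar : NonUnitalCStarAlgebra D]
  p : V → D
  t : E → D
  isCK : Γ.IsCKFamily p t

attribute [instance] CKFamily.cstar

/-- The generators: vertex projections and edge isometries. -/
def CKFamily.val {Γ : DirGraph V E} (F : CKFamily.{w} Γ) : V ⊕ E → F.D := Sum.elim F.p F.t

theorem CKFamily.norm_val_le {Γ : DirGraph V E} (F : CKFamily.{w} Γ) (g : V ⊕ E) :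
    ‖F.val g‖ ≤ 1 := by
  rcases g with v | e
  · exact (F.isCK.proj v).norm_le
  · exact norm_le_one_of_partialIsometry (F.isCK.proj _) (F.isCK.star_mul_self e)

/-- The graph C⋆-algebra: the universal C⋆-algebra for Cuntz-Krieger families. -/
abbrev CStar : Type (max u v (w + 1)) :=
  UnivCStar (ι := CKFamily.{w} Γ) CKFamily.val CKFamily.norm_val_le

/-- The canonical vertex projections of the graph C⋆-algebra. -/
def canonP (v : V) : CStar.{w} Γ := UnivCStar.gen _ _ (Sum.inl v)

/-- The canonical partial isometries of the graph C⋆-algebra. -/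
def canonT (e : E) : CStar.{w} Γ := UnivCStar.gen _ _ (Sum.inr e)

theorem isCKFamily_canon : Γ.IsCKFamily (canonP.{w} Γ) (canonT.{w} Γ) where
  proj v := by
    constructor
    · refine UnivCStar.eval_ext _ _ fun F => ?_
      rw [map_mul]
      exact (F.isCK.proj v).isIdempotentElem
    · refine UnivCStar.eval_ext _ _ fun F => ?_
      rw [map_star]
      exact (F.isCK.proj v).isSelfAdjoint
  orth v v' h := by
    refine UnivCStar.eval_ext _ _ fun F => ?_
    rw [map_mul, map_zero]
    exact F.isCK.orth v v' h
  partialIsometry e := by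
    refine UnivCStar.eval_ext _ _ fun F => ?_
    rw [map_mul, map_mul, map_star]
    exact F.isCK.partialIsometry e
  range_orth e e' h := by
    refine UnivCStar.eval_ext _ _ fun F => ?_
    rw [map_mul, map_star, map_zero]
    exact F.isCK.range_orth e e' h
  star_mul_self e := by
    refine UnivCStar.eval_ext _ _ fun F => ?_
    rw [map_mul, map_star]
    exact F.isCK.star_mul_self e
  range_le e := by
    refine UnivCStar.eval_ext _ _ fun F => ?_
    rw [map_mul, map_mul, map_star]
    exact F.isCK.range_le e
  sum_eq v hv hne := by
    refine UnivCStar.eval_ext _ _ fun F => ?_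
    simp only [map_sum, map_mul, map_star]
    exact F.isCK.sum_eq v hv hne

/-- The universal property of the graph C⋆-algebra. -/
theorem existsUnique_lift {D : Type w} [NonUnitalCStarAlgebra D] {p : V → D} {t : E → D}
    (h : Γ.IsCKFamily p t) : ∃! φ : CStar.{w} Γ →⋆ₙₐ[ℂ] D,
      (∀ v, φ (canonP Γ v) = p v) ∧ ∀ e, φ (canonT Γ e) = t e := by
  refine ⟨UnivCStar.eval CKFamily.val CKFamily.norm_val_le
    (⟨D, p, t, h⟩ : CKFamily.{w} Γ), ⟨fun _ => rfl, fun _ => rfl⟩, ?_⟩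
  rintro ψ ⟨hp, ht⟩
  refine UnivCStar.hom_ext _ _ fun g => ?_
  rcases g with v | e
  · exact hp v
  · exact ht e

end DirGraph

/-! ### The C⋆-algebra of a labelled space -/

namespace LabGraph.LabSpace

variable {V : Type u} {E : Type v} {A : Type x} {Γ : LabGraph V E A} (C : Γ.LabSpace)

/-- A representation of the labelled space together with the C⋆-algebra in which it lives. (If `C` and
the edge set are countable, it generates a separable C⋆-algebra, which has a copy in every
universe.) -/
structure Representation where
  D : Type w
  [cstar : NonUnitalCStarAlgebra D]
  p : C.sets → D
  t : Γ.labels → D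
  isRep : C.IsRepresentation p t

attribute [instance] Representation.cstar

/-- The generators: the projections and the partial isometries. -/
def Representation.val {C : Γ.LabSpace} (F : Representation.{w} C) : C.sets ⊕ Γ.labels → F.D :=
  Sum.elim F.p F.t

theorem Representation.norm_val_le {C : Γ.LabSpace} (F : Representation.{w} C)
    (g : C.sets ⊕ Γ.labels) : ‖F.val g‖ ≤ 1 := by
  rcases g with B | a
  · exact (F.isRep.proj B).norm_le
  · exact norm_le_one_of_partialIsometry (F.isRep.proj _) (F.isRep.star_mul_self a)

/-- `C*(E, π, C)`: the universal C⋆-algebra for representations of the labelled space. -/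
abbrev CStar : Type (max u x (w + 1)) :=
  UnivCStar (ι := Representation.{w} C) Representation.val Representation.norm_val_le

/-- The canonical projections of `C*(E, π, C)`. -/
def canonP (B : C.sets) : CStar.{w} C := UnivCStar.gen _ _ (Sum.inl B)

/-- The canonical partial isometries of `C*(E, π, C)`. -/
def canonT (a : Γ.labels) : CStar.{w} C := UnivCStar.gen _ _ (Sum.inr a)

theorem isRepresentation_canon : C.IsRepresentation (canonP.{w} C) (canonT.{w} C) where
  proj B := by
    constructor
    · refine UnivCStar.eval_ext _ _ fun F => ?_
      rw [map_mul]
      exact (F.isRep.proj B).isIdempotentElem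
    · refine UnivCStar.eval_ext _ _ fun F => ?_
      rw [map_star]
      exact (F.isRep.proj B).isSelfAdjoint
  partialIsometry a := by
    refine UnivCStar.eval_ext _ _ fun F => ?_
    rw [map_mul, map_mul, map_star]
    exact F.isRep.partialIsometry a
  mul_eq B B' := by
    refine UnivCStar.eval_ext _ _ fun F => ?_
    rw [map_mul]
    exact F.isRep.mul_eq B B'
  union_eq B B' := by
    refine UnivCStar.eval_ext _ _ fun F => ?_
    rw [map_sub, map_add]
    exact F.isRep.union_eq B B'
  empty_eq B hB := by
    refine UnivCStar.eval_ext _ _ fun F => ?_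
    rw [map_zero]
    exact F.isRep.empty_eq B hB
  intertwine B a := by
    refine UnivCStar.eval_ext _ _ fun F => ?_
    rw [map_mul, map_mul]
    exact F.isRep.intertwine B a
  star_mul_self a := by
    refine UnivCStar.eval_ext _ _ fun F => ?_
    rw [map_mul, map_star]
    exact F.isRep.star_mul_self a
  range_orth a b h := by
    refine UnivCStar.eval_ext _ _ fun F => ?_
    rw [map_mul, map_star, map_zero]
    exact F.isRep.range_orth a b h
  sum_eq B hB hne hs := by
    refine UnivCStar.eval_ext _ _ fun F => ?_
    simp only [map_sum, map_mul, map_star]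
    exact F.isRep.sum_eq B hB hne hs

/-- The universal property of `C*(E, π, C)`. -/
theorem existsUnique_lift {D : Type w} [NonUnitalCStarAlgebra D] {p : C.sets → D}
    {t : Γ.labels → D} (h : C.IsRepresentation p t) : ∃! φ : CStar.{w} C →⋆ₙₐ[ℂ] D,
      (∀ B, φ (canonP C B) = p B) ∧ ∀ a, φ (canonT C a) = t a := by
  refine ⟨UnivCStar.eval Representation.val Representation.norm_val_le
    (⟨D, p, t, h⟩ : Representation.{w} C), ⟨fun _ => rfl, fun _ => rfl⟩, ?_⟩
  rintro ψ ⟨hp, ht⟩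
  refine UnivCStar.hom_ext _ _ fun g => ?_
  rcases g with B | a
  · exact hp B
  · exact ht a

end LabGraph.LabSpace

end

/-! The two algebras have the same generators up to finite sums. Label-finiteness makes every `r(α)`
and `s(α)` finite, and the finite vertex sets form an accommodating collection, so all members of
`𝓔⁰` and `𝓔⁰₋` are finite (`E0_finite`, `E0minus_finite`). Once the singletons belong to the space,
its projections are therefore determined by the vertex projections: `p_B = ∑ v ∈ B, p_v`
(`p_eq_sum_vertexP`).

A Cuntz-Krieger family `(p, t)` gives a representation by `P_B = ∑ v ∈ B, p_v` and `T_a = ∑ t_e`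
over the edges labelled `a` (`isRepresentation_sum`). Conversely a representation `(P, T)` gives a
Cuntz-Krieger family by `p_v = P_{v}` and `t_e = T_a P_{r(e)}` with `a` the label of `e`
(`isCKFamily_edgeT`). Left-resolving is what makes both directions work: the edges with a given
label have distinct ranges, so the projection `P_{r(e)}` cuts exactly the summand `t_e` out of
`T_a`, and `t_e t_f* = 0` for distinct `e`, `f` with one label. The two constructions undo each
other on generators, so the homomorphisms they induce are mutually inverse
(`nonempty_starAlgEquiv`).

The universal property concerns algebras in the universe `w`, while the universal algebras
themselves live in a larger one. The homomorphisms between them are therefore assembled coordinate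
by coordinate (`exists_hom`). -/

noncomputable section

/-! ### Homomorphisms between universal C⋆-algebras -/

namespace UnivCStar

variable {G : Type u} {ι : Type v} {D : ι → Type w} [∀ i, NonUnitalCStarAlgebra (D i)]
  (f : ∀ i, G → D i) (hf : ∀ i g, ‖f i g‖ ≤ 1)

/-- A closed ⋆-subalgebra that contains the canonical generators is everything. -/
theorem mem_of_gen_mem (K : NonUnitalStarSubalgebra ℂ (UnivCStar f hf))
    (hK : IsClosed (K : Set (UnivCStar f hf))) (h : ∀ g, gen f hf g ∈ K) (y : UnivCStar f hf) :
    y ∈ K := by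
  let j : UnivCStar f hf →⋆ₙₐ[ℂ] lp D ∞ := NonUnitalStarSubalgebraClass.subtype
    (NonUnitalStarAlgebra.adjoin ℂ (Set.range (tupleGen f hf))).topologicalClosure
  -- `K` is closed in a subalgebra that is itself closed in the product, so its image is closed in
  -- the product and must contain the closure of what the generators generate.
  have hj : IsClosed ((K.map j : NonUnitalStarSubalgebra ℂ (lp D ∞)) : Set (lp D ∞)) :=
    ((NonUnitalStarSubalgebra.isClosed_topologicalClosure
      (NonUnitalStarAlgebra.adjoin ℂ
        (Set.range (tupleGen f hf)))).isClosedEmbedding_subtypeVal.isClosedMap) _ hK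
  have hle : (NonUnitalStarAlgebra.adjoin ℂ (Set.range (tupleGen f hf))).topologicalClosure ≤
      K.map j := by
    refine NonUnitalStarSubalgebra.topologicalClosure_minimal _
      (NonUnitalStarAlgebra.adjoin_le ?_) hj
    rintro _ ⟨g, rfl⟩
    exact ⟨gen f hf g, h g, rfl⟩
  obtain ⟨z, hz, hzy⟩ := hle y.2
  have hzy' : z = y := Subtype.ext hzy
  exact hzy' ▸ hz

variable {G' : Type*} {ι' : Type*} {D' : ι' → Type*} [∀ i, NonUnitalCStarAlgebra (D' i)]
  (f' : ∀ i, G' → D' i) (hf' : ∀ i g, ‖f' i g‖ ≤ 1)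

/-- The ⋆-homomorphism into an `ℓ^∞`-product with given coordinates. -/
def toProd {B : Type*} [NonUnitalCStarAlgebra B] (φ : ∀ i, B →⋆ₙₐ[ℂ] D' i) :
    B →⋆ₙₐ[ℂ] lp D' ∞ where
  toFun y := ⟨fun i => φ i y, memℓp_infty ⟨‖y‖, by
    rintro _ ⟨i, rfl⟩; exact NonUnitalStarAlgHom.norm_apply_le (φ i) y⟩⟩
  map_smul' c y := lp.ext (funext fun i => map_smul (φ i) c y)
  map_zero' := lp.ext (funext fun i => map_zero (φ i))
  map_add' y z := lp.ext (funext fun i => map_add (φ i) y z)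
  map_mul' y z := lp.ext (funext fun i => map_mul (φ i) y z)
  map_star' y := lp.ext (funext fun i => map_star (φ i) y)

/-- A ⋆-homomorphism between universal C⋆-algebras, given coordinate by coordinate. This allows
the algebras `D' i` to live in a smaller universe than the universal C⋆-algebras. -/
theorem exists_hom (z : G → UnivCStar f' hf')
    (h : ∀ i, ∃ φ : UnivCStar f hf →⋆ₙₐ[ℂ] D' i, ∀ g, φ (gen f hf g) = eval f' hf' i (z g)) :
    ∃ φ : UnivCStar f hf →⋆ₙₐ[ℂ] UnivCStar f' hf', ∀ g, φ (gen f hf g) = z g := by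
  choose φ hφ using h
  let S := (NonUnitalStarAlgebra.adjoin ℂ (Set.range (tupleGen f' hf'))).topologicalClosure
  have hgen : ∀ g, toProd φ (gen f hf g) = (z g).1 := fun g =>
    lp.ext (funext fun i => hφ i g)
  have hcont : Continuous (toProd φ) :=
    AddMonoidHomClass.continuous_of_bound (toProd φ) 1 fun y => by
      simpa using NonUnitalStarAlgHom.norm_apply_le (toProd φ) y
  -- The product map has values in the whole `ℓ^∞`-product. It maps generators into the closed
  -- subalgebra `S`, hence by continuity everything.
  have hmem : ∀ y, toProd φ y ∈ S := fun y =>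
    mem_of_gen_mem f hf (S.comap (toProd φ))
      ((NonUnitalStarSubalgebra.isClosed_topologicalClosure _).preimage hcont)
      (fun g => by
        change toProd φ (gen f hf g) ∈ S
        rw [hgen]
        exact (z g).2) y
  exact ⟨NonUnitalStarAlgHom.codRestrict (toProd φ) S hmem, fun g => Subtype.ext (hgen g)⟩

end UnivCStar

/-! ### Multiplication rules in a Cuntz-Krieger family -/

namespace DirGraph.IsCKFamily

open scoped Classical in
theorem p_mul_p {V : Type u} {E : Type v} {Γ : DirGraph V E} {D : Type w}
    [NonUnitalCStarAlgebra D] {p : V → D} {t : E → D} (h : Γ.IsCKFamily p t) (v v' : V) :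
    p v * p v' = if v = v' then p v else 0 := by
  split_ifs with hv
  · subst hv
    exact (h.proj v).isIdempotentElem
  · exact h.orth v v' hv

variable {V : Type u} {E : Type v} {Γ : DirGraph V E} {D : Type w}
  [NonUnitalCStarAlgebra D] {p : V → D} {t : E → D} (h : Γ.IsCKFamily p t)
include h

theorem source_mul (e : E) : p (Γ.s e) * t e = t e := by
  rw [← h.partialIsometry e, ← mul_assoc, h.range_le]

theorem mul_range (e : E) : t e * p (Γ.r e) = t e := by
  rw [← h.star_mul_self, ← mul_assoc, h.partialIsometry]

open scoped Classical in
theorem p_mul_t (v : V) (e : E) : p v * t e = if Γ.s e = v then t e else 0 := by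
  rw [← h.source_mul e, ← mul_assoc, h.p_mul_p]
  split_ifs with h1 h2 h2
  · rw [h1]
  · exact absurd h1.symm h2
  · exact absurd h2.symm h1
  · rw [zero_mul]

open scoped Classical in
theorem t_mul_p (e : E) (v : V) : t e * p v = if Γ.r e = v then t e else 0 := by
  rw [← h.mul_range e, mul_assoc, h.p_mul_p]
  split_ifs <;> simp

theorem t_mul_star_t {e f : E} (hef : Γ.r e ≠ Γ.r f) : t e * star (t f) = 0 := by
  rw [← h.mul_range e, ← h.mul_range f, star_mul, (h.proj _).isSelfAdjoint.star_eq, mul_assoc,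
    ← mul_assoc (p _), h.orth _ _ hef, zero_mul, mul_zero]

open scoped Classical in
theorem star_t_mul_t (e f : E) :
    star (t e) * t f = if e = f then p (Γ.r e) else 0 := by
  split_ifs with hef
  · subst hef
    exact h.star_mul_self e
  · exact h.range_orth e f hef

end DirGraph.IsCKFamily

/-! ### Words of length one, and finiteness of the sets in the labelled spaces -/

namespace LabGraph

variable {V : Type u} {E : Type v} {A : Type x} {Γ : LabGraph V E A}

theorem mem_wordRange_singleton {a : A} {v : V} :
    v ∈ Γ.wordRange [a] ↔ ∃ e, Γ.lab e = a ∧ Γ.r e = v := by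
  constructor
  · rintro ⟨l, hl, -, hla, rfl⟩
    obtain ⟨e, rfl, he⟩ := List.map_eq_singleton_iff.1 hla
    exact ⟨e, he, rfl⟩
  · rintro ⟨e, rfl, rfl⟩
    exact ⟨[e], by simp, by simp [DirGraph.IsPath], rfl, rfl⟩

theorem mem_wordSource_singleton {a : A} {v : V} :
    v ∈ Γ.wordSource [a] ↔ ∃ e, Γ.lab e = a ∧ Γ.s e = v := by
  constructor
  · rintro ⟨l, hl, -, hla, rfl⟩
    obtain ⟨e, rfl, he⟩ := List.map_eq_singleton_iff.1 hla
    exact ⟨e, he, rfl⟩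
  · rintro ⟨e, rfl, rfl⟩
    exact ⟨[e], by simp, by simp [DirGraph.IsPath], rfl, rfl⟩

theorem mem_relRange_singleton {B : Set V} {a : A} {v : V} :
    v ∈ Γ.relRange B [a] ↔ ∃ e, Γ.lab e = a ∧ Γ.s e ∈ B ∧ Γ.r e = v := by
  constructor
  · rintro ⟨l, hl, -, hla, hB, rfl⟩
    obtain ⟨e, rfl, he⟩ := List.map_eq_singleton_iff.1 hla
    exact ⟨e, he, hB, rfl⟩
  · rintro ⟨e, rfl, hB, rfl⟩
    exact ⟨[e], by simp, by simp [DirGraph.IsPath], rfl, hB, rfl⟩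

theorem mem_emittedLabels {B : Set V} {a : Γ.labels} :
    a ∈ Γ.emittedLabels B ↔ ∃ e, Γ.lab e = a ∧ Γ.s e ∈ B := by
  constructor
  · rintro ⟨v, hv, hv'⟩
    obtain ⟨e, he, rfl⟩ := mem_wordSource_singleton.1 hv'
    exact ⟨e, he, hv⟩
  · rintro ⟨e, he, hB⟩
    exact ⟨_, hB, mem_wordSource_singleton.2 ⟨e, he, rfl⟩⟩

theorem relRange_subset_wordRange (B : Set V) (α : List A) :
    Γ.relRange B α ⊆ Γ.wordRange α := by
  rintro v ⟨l, hl, hp, hα, -, hv⟩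
  exact ⟨l, hl, hp, hα, hv⟩

theorem IsLabelFinite.preimage_finite (hfin : Γ.IsLabelFinite) (a : A) :
    {e | Γ.lab e = a}.Finite := by
  by_cases ha : a ∈ Γ.labels
  · exact hfin a ha
  · refine Set.finite_empty.subset fun e he => ha ⟨e, he⟩

theorem IsLabelFinite.wordRange_finite (hfin : Γ.IsLabelFinite) {α : List A} :
    (Γ.wordRange α).Finite := by
  by_cases hα : α = []
  · refine Set.finite_empty.subset ?_
    rintro v ⟨l, hl, -, hla, -⟩
    exact hl (List.map_eq_nil_iff.1 (hla.trans hα))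
  -- Only the last letter matters: a path representing `α` ends in one of the finitely many edges
  -- that carry it.
  refine ((hfin.preimage_finite (α.getLast hα)).image Γ.r).subset ?_
  rintro v ⟨l, hl, -, rfl, rfl⟩
  exact ⟨l.getLast hl, (List.getLast_map _).symm, rfl⟩

theorem IsLabelFinite.wordSource_finite (hfin : Γ.IsLabelFinite) {α : List A} :
    (Γ.wordSource α).Finite := by
  by_cases hα : α = []
  · refine Set.finite_empty.subset ?_
    rintro v ⟨l, hl, -, hla, -⟩
    exact hl (List.map_eq_nil_iff.1 (hla.trans hα))
  refine ((hfin.preimage_finite (α.head hα)).image Γ.s).subset ?_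
  rintro v ⟨l, hl, -, rfl, rfl⟩
  exact ⟨l.head hl, (List.head_map _).symm, rfl⟩

/-- Relative ranges are finite even for infinite `B`, being contained in `r(α)`. By minimality, `𝓔⁰`
and `𝓔⁰₋` then contain only finite sets, since their generators are finite. -/
theorem IsLabelFinite.isAccommodating_finite (hfin : Γ.IsLabelFinite) :
    Γ.IsAccommodating {B | B.Finite} where
  wordRange_mem _ _ := hfin.wordRange_finite
  relRange_mem _ _ _ _ := hfin.wordRange_finite.subset (relRange_subset_wordRange _ _)
  inter_mem _ hB _ _ := hB.subset Set.inter_subset_left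
  union_mem _ hB _ hB' := Set.Finite.union hB hB'

theorem IsLabelFinite.E0_finite (hfin : Γ.IsLabelFinite) : ∀ B ∈ Γ.E0.sets, B.Finite := by
  refine fun B hB => hB _ hfin.isAccommodating_finite ?_
  rintro _ ((⟨v, -, rfl⟩ | ⟨α, -, rfl⟩) | ⟨α, -, rfl⟩)
  exacts [Set.finite_singleton v, hfin.wordRange_finite, hfin.wordSource_finite]

theorem IsLabelFinite.E0minus_finite (hfin : Γ.IsLabelFinite) :
    ∀ B ∈ Γ.E0minus.sets, B.Finite := by
  refine fun B hB => hB _ hfin.isAccommodating_finite ?_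
  rintro _ (⟨v, -, rfl⟩ | ⟨α, -, rfl⟩)
  exacts [Set.finite_singleton v, hfin.wordRange_finite]

/-- The edges labelled `a`. -/
def IsLabelFinite.edges (hfin : Γ.IsLabelFinite) (a : A) : Finset E :=
  (hfin.preimage_finite a).toFinset

theorem IsLabelFinite.mem_edges (hfin : Γ.IsLabelFinite) {a : A} {e : E} :
    e ∈ hfin.edges a ↔ Γ.lab e = a := by
  simp [IsLabelFinite.edges]

/-- The form in which left-resolving is mostly used below: within one label, an edge is recovered
from its range. -/
theorem IsLeftResolving.injOn_edges (hres : Γ.IsLeftResolving) (hfin : Γ.IsLabelFinite) (a : A) :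
    Set.InjOn Γ.r (hfin.edges a : Set E) := by
  intro e he f hf hef
  refine hres (Γ.r f) hef rfl ?_
  rw [hfin.mem_edges.1 he, hfin.mem_edges.1 hf]

namespace LabSpace

variable {C : Γ.LabSpace} {D : Type w} [NonUnitalCStarAlgebra D]

/-! ### From a Cuntz-Krieger family to a representation -/

section ofCK

variable {p : V → D} {t : E → D} (hC : ∀ B ∈ C.sets, B.Finite) (hfin : Γ.IsLabelFinite)

/-- The projection of a finite vertex set, as the sum of its vertex projections. -/
def sumP (p : V → D) (B : C.sets) : D := ∑ v ∈ (hC B.1 B.2).toFinset, p v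

/-- The sum of the edge isometries with label `a`. -/
def sumT (t : E → D) (a : Γ.labels) : D := ∑ e ∈ hfin.edges a.1, t e

open scoped Classical in
theorem sumP_mul_t (h : Γ.IsCKFamily p t) (B : C.sets) (e : E) :
    sumP hC p B * t e = if Γ.s e ∈ B.1 then t e else 0 := by
  simp [sumP, Finset.sum_mul, h.p_mul_t]

open scoped Classical in
theorem t_mul_sumP (h : Γ.IsCKFamily p t) (B : C.sets) (e : E) :
    t e * sumP hC p B = if Γ.r e ∈ B.1 then t e else 0 := by
  simp [sumP, Finset.mul_sum, h.t_mul_p]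

open scoped Classical in
theorem sumP_mul_p (h : Γ.IsCKFamily p t) (B : C.sets) (v : V) :
    sumP hC p B * p v = if v ∈ B.1 then p v else 0 := by
  have h1 : ∀ w, p w * p v = if w = v then p v else 0 := fun w => by
    rw [h.p_mul_p]
    split_ifs with hw
    · rw [hw]
    · rfl
  simp [sumP, Finset.sum_mul, h1]

theorem star_sumP (h : Γ.IsCKFamily p t) (B : C.sets) :
    star (sumP hC p B) = sumP hC p B := by
  simp only [sumP, star_sum, (h.proj _).isSelfAdjoint.star_eq]

theorem sumP_mul_sumP (h : Γ.IsCKFamily p t) (B B' : C.sets) :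
    sumP hC p B * sumP hC p B' = sumP hC p (C.interSet B B') := by
  classical
  conv_lhs => rw [sumP.eq_def (B := B'), Finset.mul_sum]
  simp only [sumP_mul_p hC h]
  rw [← Finset.sum_filter]
  refine Finset.sum_congr ?_ fun _ _ => rfl
  ext v
  simp [interSet, and_comm]

theorem sumP_union (B B' : C.sets) :
    sumP hC p (C.unionSet B B') = sumP hC p B + sumP hC p B' - sumP hC p (C.interSet B B') := by
  classical
  rw [eq_sub_iff_add_eq]
  have h1 : (hC _ (C.unionSet B B').2).toFinset =
      (hC _ B.2).toFinset ∪ (hC _ B'.2).toFinset := by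
    ext v
    simp [unionSet]
  have h2 : (hC _ (C.interSet B B').2).toFinset =
      (hC _ B.2).toFinset ∩ (hC _ B'.2).toFinset := by
    ext v
    simp [interSet]
  rw [sumP, sumP, h1, h2]
  exact Finset.sum_union_inter

open scoped Classical in
theorem sumP_mul_sumT (h : Γ.IsCKFamily p t) (B : C.sets) (a : Γ.labels) :
    sumP hC p B * sumT hfin t a = ∑ e ∈ hfin.edges a.1 with Γ.s e ∈ B.1, t e := by
  rw [sumT, Finset.mul_sum, Finset.sum_filter]
  simp only [sumP_mul_t hC h]

theorem sumP_intertwine (h : Γ.IsCKFamily p t) (hres : Γ.IsLeftResolving)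
    (B : C.sets) (a : Γ.labels) :
    sumP hC p B * sumT hfin t a = sumT hfin t a * sumP hC p (C.relRangeSet B a) := by
  classical
  rw [sumP_mul_sumT hC hfin h, Finset.sum_filter, sumT, Finset.sum_mul]
  refine Finset.sum_congr rfl fun e he => ?_
  rw [t_mul_sumP hC h]
  refine if_congr ?_ rfl rfl
  rw [relRangeSet, mem_relRange_singleton]
  constructor
  · exact fun hB => ⟨e, hfin.mem_edges.1 he, hB, rfl⟩
  · rintro ⟨f, hf, hB, hr⟩
    -- An edge labelled `a` that starts in `B` and ends at `r(e)` can only be `e`, so the range of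
    -- `e` lying in `r(B, a)` forces its source to lie in `B`.
    rwa [← hres.injOn_edges hfin a.1 (hfin.mem_edges.2 hf) he hr]

theorem star_sumT_mul_sumT (h : Γ.IsCKFamily p t) (hres : Γ.IsLeftResolving) (a : Γ.labels) :
    star (sumT hfin t a) * sumT hfin t a = sumP hC p (C.rangeSet a) := by
  classical
  have h1 : (hC _ (C.rangeSet a).2).toFinset = (hfin.edges a.1).image Γ.r := by
    ext v
    simp [rangeSet, mem_wordRange_singleton, hfin.mem_edges]
  rw [sumP, h1, Finset.sum_image (hres.injOn_edges hfin a.1), sumT, star_sum, Finset.sum_mul]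
  simp only [Finset.mul_sum, h.star_t_mul_t]
  refine Finset.sum_congr rfl fun e he => ?_
  rw [Finset.sum_ite_eq, if_pos he]

theorem sumT_mul_rangeSet (h : Γ.IsCKFamily p t) (a : Γ.labels) :
    sumT hfin t a * sumP hC p (C.rangeSet a) = sumT hfin t a := by
  classical
  rw [sumT, Finset.sum_mul]
  refine Finset.sum_congr rfl fun e he => ?_
  rw [t_mul_sumP hC h, if_pos]
  exact mem_wordRange_singleton.2 ⟨e, hfin.mem_edges.1 he, rfl⟩

theorem isRepresentation_sum (h : Γ.IsCKFamily p t) (hrow : Γ.IsRowFinite)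
    (hres : Γ.IsLeftResolving) : C.IsRepresentation (sumP hC p) (sumT hfin t) where
  proj B := by
    constructor
    · rw [IsIdempotentElem, sumP_mul_sumP hC h]
      exact congrArg _ (Subtype.ext (Set.inter_self _))
    · exact star_sumP hC h B
  partialIsometry a := by
    rw [mul_assoc, star_sumT_mul_sumT hC hfin h hres, sumT_mul_rangeSet hC hfin h]
  mul_eq := sumP_mul_sumP hC h
  union_eq := sumP_union hC
  empty_eq B hB := by
    simp only [sumP, hB, Set.Finite.toFinset_empty, Finset.sum_empty]
  intertwine := sumP_intertwine hC hfin h hres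
  star_mul_self := star_sumT_mul_sumT hC hfin h hres
  range_orth a b hab := by
    rw [sumT, sumT, star_sum, Finset.sum_mul]
    refine Finset.sum_eq_zero fun e he => ?_
    rw [Finset.mul_sum]
    refine Finset.sum_eq_zero fun f hf => h.range_orth e f ?_
    rintro rfl
    exact hab (Subtype.ext ((hfin.mem_edges.1 he).symm.trans (hfin.mem_edges.1 hf)))
  sum_eq B hB hne hs := by
    classical
    -- Moving the projection to the left restricts one factor to edges starting in `B`. The cross
    -- terms `t_e t_f*` vanish because distinct edges with the same label have different ranges.
    have hterm : ∀ a : Γ.labels, sumT hfin t a * sumP hC p (C.relRangeSet B a) *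
        star (sumT hfin t a) = ∑ e ∈ hfin.edges a.1 with Γ.s e ∈ B.1, t e * star (t e) := by
      intro a
      rw [← sumP_intertwine hC hfin h hres, sumP_mul_sumT hC hfin h, Finset.sum_mul]
      refine Finset.sum_congr rfl fun e he => ?_
      have he' := (Finset.mem_filter.1 he).1
      rw [sumT, star_sum, Finset.mul_sum]
      refine Finset.sum_eq_single_of_mem e he' fun f hf hfe => h.t_mul_star_t fun hr => ?_
      exact hfe (hres.injOn_edges hfin a.1 hf he' hr.symm)
    have hsum : ∀ v ∈ (hC _ B.2).toFinset, p v = ∑ e ∈ (hrow v).toFinset, t e * star (t e) := by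
      intro v hv
      refine h.sum_eq v (hrow v) ?_
      have := hs v ((hC _ B.2).mem_toFinset.1 hv)
      simpa [DirGraph.IsSink, Set.Nonempty] using this
    -- Both sides are now the sum of `t_e t_e*` over the edges leaving `B`, grouped by source on the
    -- left and by label on the right.
    rw [sumP, Finset.sum_congr rfl hsum, Finset.sum_congr rfl fun a _ => hterm a,
      ← Finset.sum_biUnion, ← Finset.sum_biUnion]
    · refine Finset.sum_congr ?_ fun _ _ => rfl
      ext e
      simp only [Finset.mem_biUnion, Set.Finite.mem_toFinset, Set.mem_ofPred_eq,
        Finset.mem_filter, hfin.mem_edges, mem_emittedLabels]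
      constructor
      · rintro ⟨v, hv, rfl⟩
        exact ⟨⟨_, e, rfl⟩, ⟨e, rfl, hv⟩, rfl, hv⟩
      · rintro ⟨a, -, -, hv⟩
        exact ⟨_, hv, rfl⟩
    · intro a _ b _ hab
      refine Finset.disjoint_left.2 fun e he he' => hab (Subtype.ext ?_)
      rw [← hfin.mem_edges.1 (Finset.mem_filter.1 he).1,
        hfin.mem_edges.1 (Finset.mem_filter.1 he').1]
    · intro v _ w _ hvw
      refine Finset.disjoint_left.2 fun e he he' => hvw ?_
      simp only [Set.Finite.mem_toFinset, Set.mem_ofPred_eq] at he he'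
      rw [← he, ← he']

end ofCK

/-! ### From a representation to a Cuntz-Krieger family -/

section toCK

variable {P : C.sets → D} {T : Γ.labels → D} (hsing : ∀ v, {v} ∈ C.sets)

/-- The label of an edge, as a label that occurs. -/
def edgeLabel (Γ : LabGraph V E A) (e : E) : Γ.labels := ⟨Γ.lab e, e, rfl⟩

/-- The projection of a single vertex. -/
def vertexP (P : C.sets → D) (v : V) : D := P ⟨{v}, hsing v⟩

/-- The part of the partial isometry of a label that belongs to an edge. -/
def edgeT (P : C.sets → D) (T : Γ.labels → D) (e : E) : D :=
  T (edgeLabel Γ e) * vertexP hsing P (Γ.r e)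

theorem p_mul_vertexP_of_mem (h : C.IsRepresentation P T) {B : C.sets} {v : V} (hv : v ∈ B.1) :
    P B * vertexP hsing P v = vertexP hsing P v := by
  rw [vertexP, h.mul_eq]
  exact congrArg _ (Subtype.ext (Set.inter_eq_right.2 (Set.singleton_subset_iff.2 hv)))

theorem p_mul_vertexP_of_notMem (h : C.IsRepresentation P T) {B : C.sets} {v : V}
    (hv : v ∉ B.1) : P B * vertexP hsing P v = 0 := by
  rw [vertexP, h.mul_eq]
  exact h.empty_eq _ (Set.inter_singleton_eq_empty.2 hv)

theorem star_vertexP (h : C.IsRepresentation P T) (v : V) :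
    star (vertexP hsing P v) = vertexP hsing P v :=
  (h.proj _).isSelfAdjoint

theorem vertexP_mul_self (h : C.IsRepresentation P T) (v : V) :
    vertexP hsing P v * vertexP hsing P v = vertexP hsing P v :=
  (h.proj _).isIdempotentElem

theorem vertexP_mul_of_ne (h : C.IsRepresentation P T) {v w : V} (hvw : v ≠ w) :
    vertexP hsing P v * vertexP hsing P w = 0 :=
  p_mul_vertexP_of_notMem hsing h (B := ⟨{v}, hsing v⟩) fun hw => hvw hw.symm

/-- Iterates the union relation over the points of the set; disjointness removes the correction
term. The empty set is treated apart because it need not belong to the space. -/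
theorem p_eq_sum_vertexP (h : C.IsRepresentation P T) (s : Finset V) (B : C.sets)
    (hB : B.1 = s) : P B = ∑ v ∈ s, vertexP hsing P v := by
  classical
  rcases s.eq_empty_or_nonempty with rfl | hs
  · rw [Finset.sum_empty]
    exact h.empty_eq B (by simpa using hB)
  -- Membership in the space has to be built along with the formula, so the induction starts from
  -- singletons and adds a point at a time by unions.
  suffices H : ∃ B' : C.sets, B'.1 = s ∧ P B' = ∑ v ∈ s, vertexP hsing P v by
    obtain ⟨B', hB', hP⟩ := H
    rw [← hP, Subtype.ext (hB.trans hB'.symm)]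
  clear hB B
  induction hs using Finset.Nonempty.cons_induction with
  | singleton v => exact ⟨⟨{v}, hsing v⟩, by simp, by simp [vertexP]⟩
  | cons v s hv hs ih =>
    obtain ⟨B, hB, hP⟩ := ih
    refine ⟨C.unionSet ⟨{v}, hsing v⟩ B, ?_, ?_⟩
    · simp [unionSet, hB]
    · rw [h.union_eq, h.empty_eq (C.interSet _ _), sub_zero, Finset.sum_cons, hP, vertexP]
      simpa [interSet, hB] using hv

theorem star_edgeT_mul_edgeT (h : C.IsRepresentation P T) (e : E) :
    star (edgeT hsing P T e) * edgeT hsing P T e = vertexP hsing P (Γ.r e) := by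
  rw [edgeT, star_mul, star_vertexP hsing h, mul_assoc, ← mul_assoc (star _), h.star_mul_self,
    p_mul_vertexP_of_mem hsing h, vertexP_mul_self hsing h]
  exact mem_wordRange_singleton.2 ⟨e, rfl, rfl⟩

theorem edgeT_mul_vertexP (h : C.IsRepresentation P T) (e : E) :
    edgeT hsing P T e * vertexP hsing P (Γ.r e) = edgeT hsing P T e := by
  rw [edgeT, mul_assoc, vertexP_mul_self hsing h]

/-- Moved past `T_a`, the projection of `s(e)` becomes that of `r({s(e)}, a)`, which contains
`r(e)`. -/
theorem vertexP_mul_edgeT (h : C.IsRepresentation P T) (e : E) :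
    vertexP hsing P (Γ.s e) * edgeT hsing P T e = edgeT hsing P T e := by
  rw [edgeT, ← mul_assoc, vertexP, h.intertwine, mul_assoc, p_mul_vertexP_of_mem hsing h]
  exact mem_relRange_singleton.2 ⟨e, rfl, rfl, rfl⟩

theorem star_edgeT_mul_edgeT_of_ne (h : C.IsRepresentation P T) (hres : Γ.IsLeftResolving)
    {e f : E} (hef : e ≠ f) : star (edgeT hsing P T e) * edgeT hsing P T f = 0 := by
  rw [edgeT, edgeT, star_mul, star_vertexP hsing h, mul_assoc, ← mul_assoc (star _)]
  -- With equal labels the ranges differ by left-resolving and the vertex projections are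
  -- orthogonal; with different labels `T_a* T_b` already vanishes.
  by_cases hl : edgeLabel Γ e = edgeLabel Γ f
  · have hr : Γ.r e ≠ Γ.r f := fun hr => hef (hres _ hr rfl (congrArg Subtype.val hl))
    rw [← hl, h.star_mul_self, p_mul_vertexP_of_mem hsing h, vertexP_mul_of_ne hsing h hr]
    exact mem_wordRange_singleton.2 ⟨f, congrArg Subtype.val hl.symm, rfl⟩
  · rw [h.range_orth _ _ hl, zero_mul, mul_zero]

theorem isCKFamily_edgeT (h : C.IsRepresentation P T) (hres : Γ.IsLeftResolving)
    (hfin : Γ.IsLabelFinite) : Γ.IsCKFamily (vertexP hsing P) (edgeT hsing P T) where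
  proj v := h.proj _
  orth v w hvw := vertexP_mul_of_ne hsing h hvw
  partialIsometry e := by
    rw [mul_assoc, star_edgeT_mul_edgeT hsing h, edgeT_mul_vertexP hsing h]
  range_orth e f hef := star_edgeT_mul_edgeT_of_ne hsing h hres hef
  star_mul_self := star_edgeT_mul_edgeT hsing h
  range_le e := by rw [← mul_assoc, vertexP_mul_edgeT hsing h]
  sum_eq v hv hne := by
    classical
    have hlab : Γ.emittedLabels {v} = edgeLabel Γ '' {e | Γ.s e = v} := by
      ext a
      rw [mem_emittedLabels]
      exact exists_congr fun e =>
        ⟨fun ⟨h1, h2⟩ => ⟨h2, Subtype.ext h1⟩, fun ⟨h1, h2⟩ => ⟨congrArg Subtype.val h2, h1⟩⟩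
    have hL : (Γ.emittedLabels {v}).Finite := hlab ▸ hv.image _
    have hLne : (Γ.emittedLabels {v}).Nonempty := hlab ▸ hne.image _
    obtain ⟨e₀, he₀⟩ := hne
    -- The summation relation for the set `{v}`, which contains no sink because `e₀` leaves `v`.
    rw [vertexP, h.sum_eq ⟨{v}, hsing v⟩ hL hLne
      (by rintro _ rfl hs; exact hs e₀ he₀)]
    have hmap : ∀ e ∈ hv.toFinset, edgeLabel Γ e ∈ hL.toFinset := fun e he => by
      rw [Set.Finite.mem_toFinset, hlab]
      exact ⟨e, hv.mem_toFinset.1 he, rfl⟩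
    -- The edges leaving `v` are grouped by label. For one label `a` their ranges are distinct and
    -- fill `r({v}, a)`, so the term of `a` splits into the `t_e t_e*`.
    rw [← Finset.sum_fiberwise_of_maps_to hmap]
    refine Finset.sum_congr rfl fun a _ => ?_
    have hinj : Set.InjOn Γ.r ({e ∈ hv.toFinset | edgeLabel Γ e = a} : Finset E) := by
      refine (hres.injOn_edges hfin a.1).mono fun e he => ?_
      exact hfin.mem_edges.2 (congrArg Subtype.val (Finset.mem_filter.1 he).2)
    rw [p_eq_sum_vertexP hsing h ({e ∈ hv.toFinset | edgeLabel Γ e = a}.image Γ.r)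
      (C.relRangeSet ⟨{v}, hsing v⟩ a), Finset.sum_image hinj, Finset.mul_sum, Finset.sum_mul]
    · refine Finset.sum_congr rfl fun e he => ?_
      rw [edgeT, (Finset.mem_filter.1 he).2, star_mul, star_vertexP hsing h, ← mul_assoc,
        mul_assoc (T a) (vertexP _ _ _) (vertexP _ _ _), vertexP_mul_self hsing h]
    · ext w
      simp only [relRangeSet, mem_relRange_singleton, Finset.coe_image, Finset.coe_filter,
        Set.Finite.mem_toFinset, Set.mem_ofPred_eq, Set.mem_image, edgeLabel, Subtype.ext_iff,
        Set.mem_singleton_iff]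
      exact exists_congr fun e => by tauto

/-- Since `T_a = T_a P_{r(a)}`, it suffices to split `P_{r(a)}` into vertex projections, one for
each edge labelled `a`. -/
theorem t_eq_sum_edgeT (h : C.IsRepresentation P T) (hres : Γ.IsLeftResolving)
    (hfin : Γ.IsLabelFinite) (a : Γ.labels) :
    T a = ∑ e ∈ hfin.edges a.1, edgeT hsing P T e := by
  classical
  conv_lhs => rw [← h.partialIsometry a, mul_assoc, h.star_mul_self]
  rw [p_eq_sum_vertexP hsing h ((hfin.edges a.1).image Γ.r), Finset.sum_image
    (hres.injOn_edges hfin a.1), Finset.mul_sum]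
  · refine Finset.sum_congr rfl fun e he => ?_
    rw [edgeT, show edgeLabel Γ e = a from Subtype.ext (hfin.mem_edges.1 he)]
  · ext v
    simp [rangeSet, mem_wordRange_singleton, hfin.mem_edges]

end toCK

/-! ### The isomorphism -/

/-- If a labelled space consists of finite sets and contains all singletons, its C⋆-algebra is the
C⋆-algebra of the underlying graph. -/
theorem nonempty_starAlgEquiv (C : Γ.LabSpace) (hrow : Γ.IsRowFinite)
    (hres : Γ.IsLeftResolving) (hfin : Γ.IsLabelFinite) (hC : ∀ B ∈ C.sets, B.Finite)
    (hsing : ∀ v, {v} ∈ C.sets) :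
    Nonempty (CStar.{w} C ≃⋆ₐ[ℂ] DirGraph.CStar.{w} Γ.toDirGraph) := by
  classical
  have hck := Γ.toDirGraph.isCKFamily_canon.{w}
  have hrep := C.isRepresentation_canon.{w}
  obtain ⟨φ, hφ⟩ := UnivCStar.exists_hom (ι := Representation.{w} C) Representation.val
    Representation.norm_val_le (ι' := DirGraph.CKFamily.{w} Γ.toDirGraph) DirGraph.CKFamily.val
    DirGraph.CKFamily.norm_val_le
    (Sum.elim (sumP hC (Γ.toDirGraph.canonP)) (sumT hfin (Γ.toDirGraph.canonT))) fun F => by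
      -- In the coordinate of a Cuntz-Krieger family `F`, the algebra `F.D` lies in the universe
      -- `w`, so the universal property applies to the representation built from `F`.
      obtain ⟨φ, ⟨hP, hT⟩, -⟩ :=
        C.existsUnique_lift (isRepresentation_sum hC hfin F.isCK hrow hres)
      refine ⟨φ, ?_⟩
      rintro (B | a)
      · refine (hP B).trans ?_
        simp only [Sum.elim_inl, sumP, map_sum]
        rfl
      · refine (hT a).trans ?_
        simp only [Sum.elim_inr, sumT, map_sum]
        rfl
  obtain ⟨ψ, hψ⟩ := UnivCStar.exists_hom (ι := DirGraph.CKFamily.{w} Γ.toDirGraph)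
    DirGraph.CKFamily.val DirGraph.CKFamily.norm_val_le (ι' := Representation.{w} C)
    Representation.val Representation.norm_val_le
    (Sum.elim (vertexP hsing C.canonP) (edgeT hsing C.canonP C.canonT)) fun F => by
      obtain ⟨φ, ⟨hP, hT⟩, -⟩ :=
        Γ.toDirGraph.existsUnique_lift (isCKFamily_edgeT hsing F.isRep hres hfin)
      refine ⟨φ, ?_⟩
      rintro (v | e)
      · exact hP v
      · refine (hT e).trans ?_
        simp only [Sum.elim_inr, edgeT, map_mul]
        rfl
  have hφP : ∀ B, φ (C.canonP B) = sumP hC Γ.toDirGraph.canonP B := fun B => hφ (Sum.inl B)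
  have hφT : ∀ a, φ (C.canonT a) = sumT hfin Γ.toDirGraph.canonT a := fun a => hφ (Sum.inr a)
  have hψP : ∀ v, ψ (Γ.toDirGraph.canonP v) = vertexP hsing C.canonP v := fun v => hψ (Sum.inl v)
  have hψT : ∀ e, ψ (Γ.toDirGraph.canonT e) = edgeT hsing C.canonP C.canonT e :=
    fun e => hψ (Sum.inr e)
  have hleft : ψ.comp φ = NonUnitalStarAlgHom.id ℂ _ := by
    refine UnivCStar.hom_ext _ _ ?_
    rintro (B | a)
    · change ψ (φ (C.canonP B)) = C.canonP B
      rw [hφP, sumP, map_sum, p_eq_sum_vertexP hsing hrep _ B (hC _ B.2).coe_toFinset.symm]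
      exact Finset.sum_congr rfl fun v _ => hψP v
    · change ψ (φ (C.canonT a)) = C.canonT a
      rw [hφT, sumT, map_sum, t_eq_sum_edgeT hsing hrep hres hfin a]
      exact Finset.sum_congr rfl fun e _ => hψT e
  have hvert : ∀ v, φ (vertexP hsing C.canonP v) = Γ.toDirGraph.canonP v := fun v => by
    rw [vertexP, hφP, sumP]
    simp
  have hright : φ.comp ψ = NonUnitalStarAlgHom.id ℂ _ := by
    refine UnivCStar.hom_ext _ _ ?_
    rintro (v | e)
    · change φ (ψ (Γ.toDirGraph.canonP v)) = Γ.toDirGraph.canonP v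
      rw [hψP, hvert]
    · change φ (ψ (Γ.toDirGraph.canonT e)) = Γ.toDirGraph.canonT e
      -- Multiplying the sum of all `t_f` with the label of `e` by `p_{r(e)}` keeps only those
      -- ending at `r(e)`, and by left-resolving that is `e` alone.
      rw [hψT, edgeT, map_mul, hφT, hvert, sumT, Finset.sum_mul,
        Finset.sum_eq_single_of_mem (s := hfin.edges (edgeLabel Γ e).1) e
          (hfin.mem_edges.2 rfl), hck.mul_range]
      intro f hf hfe
      rw [hck.t_mul_p, if_neg]
      exact fun hr => hfe (hres.injOn_edges hfin _ hf (hfin.mem_edges.2 rfl) hr)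
  exact ⟨StarAlgEquiv.ofBijective φ
    ⟨Function.LeftInverse.injective fun y => DFunLike.congr_fun hleft y,
      Function.RightInverse.surjective fun y => DFunLike.congr_fun hright y⟩⟩

end LabSpace

end LabGraph

end

theorem theorem6p6 {V : Type u} {E : Type v} {A : Type x} [Countable V] [Countable E]
    (Γ : LabGraph V E A) (hrow : Γ.IsRowFinite) (hres : Γ.IsLeftResolving)
    (hfin : Γ.IsLabelFinite) :
    ((∀ v, {v} ∈ Γ.E0.sets) →
      Nonempty (LabGraph.LabSpace.CStar.{w} Γ.E0 ≃⋆ₐ[ℂ] DirGraph.CStar.{w} Γ.toDirGraph)) ∧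
    ((∀ v, {v} ∈ Γ.E0minus.sets) →
      Nonempty (LabGraph.LabSpace.CStar.{w} Γ.E0minus ≃⋆ₐ[ℂ]
        DirGraph.CStar.{w} Γ.toDirGraph)) := by
  exact ⟨Γ.E0.nonempty_starAlgEquiv hrow hres hfin hfin.E0_finite,
    Γ.E0minus.nonempty_starAlgEquiv hrow hres hfin hfin.E0minus_finite⟩
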